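/- For $n\ge 3$ let $\mathrm{Dr}(3,n)\subset\mathbb{R}^{\binom{[n]}{3}}$ be the Dressian: the set of all real vectors $w=(w_X)$, indexed by the $3$-element subsets $X$ of $[n]=\{1,\dots,n\}$, such that for all pairwise distinct $s,i,j,k,l\in[n]$ the minimum of $$w_{sij}+w_{skl},\qquad w_{sik}+w_{sjl},\qquad w_{sil}+w_{sjk}$$ is attained at least twice. It is the support of a polyhedral fan (the Plücker fan), in which two vectors lie in the relative interior of the same cone if and only if, for all $s,i,j,k,l$, the minimum is attained at the same terms. The lineality space of this fan is $\{(\sum_{i\in X}a_i)_X : a\in\mathbb{R}^n\}$. Let $\dim \mathrm{Dr}(3,n)$ be the dimension of the Dressian as a polyhedral complex, i.e. of the spherical polytopal complex obtained by factoring out the lineality space and intersecting the resulting pointed fan with the unit sphere; it is one less than the maximal dimension of a cone of the pointed fan (and $-1$ if the only cone is $\{0\}$). Then $$\dim \mathrm{Dr}(3,n)=\Theta(n^2)\qquad (n\to\infty).$$ More precisely, $\dim \mathrm{Dr}(3,n)\le\binom{n-2}{2}-1$ for all $n\ge 3$, and $\dim \mathrm{Dr}(3,n)\ge \frac{n^2}{24}-\frac{n}{12}-1$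 for all $n\ge 5$. -/

import Mathlib

open Filter Asymptotics

noncomputable section

namespace Dressian

/-- The `d`-element subsets of the `n`-element ground set. -/
abbrev Subsets (d n : ℕ) : Type := {X : Finset (Fin n) // X.card = d}

/-- The ambient space of weight vectors, with one real coordinate for each `d`-element subset. -/
abbrev Weight (d n : ℕ) : Type := Subsets d n → ℝ

/-- The index of a three term Plücker relation
`p_{Sij} p_{Skl} - p_{Sik} p_{Sjl} + p_{Sil} p_{Sjk}`: a set `S` of `d - 2` elements and pairwise
distinct elements `i = e 0`, `j = e 1`, `k = e 2`, `l = e 3` outside `S`. -/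
structure ThreeTerm (d n : ℕ) where
  S : Finset (Fin n)
  e : Fin 4 ↪ Fin n
  card_S : S.card + 2 = d
  notMem_S : ∀ a, e a ∉ S

/-- The `d`-element set `S ∪ {e a, e b}`. -/
def ThreeTerm.idx {d n : ℕ} (R : ThreeTerm d n) (a b : Fin 4) (h : a ≠ b) : Subsets d n :=
  ⟨insert (R.e a) (insert (R.e b) R.S), by
    have hab : R.e a ∉ insert (R.e b) R.S := by
      simp [R.notMem_S a, h]
    rw [Finset.card_insert_of_notMem hab, Finset.card_insert_of_notMem (R.notMem_S b)]
    exact R.card_S⟩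

/-- The weights of the three monomials of a three term relation. -/
def ThreeTerm.termWeight {d n : ℕ} (R : ThreeTerm d n) (w : Weight d n) : Fin 3 → ℝ :=
  ![w (R.idx 0 1 (by decide)) + w (R.idx 2 3 (by decide)),
    w (R.idx 0 2 (by decide)) + w (R.idx 1 3 (by decide)),
    w (R.idx 0 3 (by decide)) + w (R.idx 1 2 (by decide))]

/-- The monomials that occur in the initial form of the relation `R` with respect to `w`, i.e. those
of lowest weight. As the coefficients are fixed, this set determines the initial form. -/
def ThreeTerm.initialTerms {d n : ℕ} (R : ThreeTerm d n) (w : Weight d n) : Set (Fin 3) :=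
  {t | ∀ s, R.termWeight w t ≤ R.termWeight w s}

/-- The support of the Dressian `Dr(d,n)` as a fan: the tropical prevariety of all three term Plücker
relations, where the minimum of the three weights has to be attained at least twice. -/
def dressian (d n : ℕ) : Set (Weight d n) :=
  {w | ∀ R : ThreeTerm d n, (R.initialTerms w).Nontrivial}

/-- The closed cone of the Plücker fan structure that has `w` in its relative interior. The relative
interiors are the classes of vectors that specify the same initial form for each relation. -/
def pluckerCone {d n : ℕ} (w : Weight d n) : Set (Weight d n) :=
  closure {v | ∀ R : ThreeTerm d n, R.initialTerms v = R.initialTerms w}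

/-- The Dressian with its Plücker fan structure, as a set of closed cones. -/
def fan (d n : ℕ) : Set (Set (Weight d n)) :=
  {C | ∃ w ∈ dressian d n, C = pluckerCone w}

/-- The lineality space of the fan: all vectors of the form `X ↦ ∑ i ∈ X, a i`. -/
def lineality (d n : ℕ) : Submodule ℝ (Weight d n) :=
  LinearMap.range
    (LinearMap.pi fun X : Subsets d n => ∑ i ∈ X.1, LinearMap.proj (R := ℝ) (φ := fun _ => ℝ) i)

/-- The pointed fan obtained from the Dressian by factoring out the lineality space. -/
def pointedFan (d n : ℕ) : Set (Set (Weight d n ⧸ lineality d n)) :=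
  {C | ∃ D ∈ fan d n, C = (lineality d n).mkQ '' D}

/-- The dimension of the cell of the underlying spherical polytopal complex that a cone `C` of a
pointed fan defines. The intersection of `C` with the unit sphere has dimension `dim C - 1`; the
cone `{0}` gives the empty cell, of dimension `-1`. -/
def cellDim {V : Type} [AddCommGroup V] [Module ℝ V] (C : Set V) : ℤ :=
  (Module.finrank ℝ (Submodule.span ℝ C) : ℤ) - 1

/-- The dimension of the Dressian `Dr(d,n)` as a polyhedral complex, that is, of the spherical
polytopal complex underlying the pointed fan: the largest dimension of a cell. -/
def dim (d n : ℕ) : ℤ :=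
  sSup (cellDim '' pointedFan d n)

/-- The supremum in the definition of the dimension is a maximum. -/
theorem isGreatest_dim (d n : ℕ) : IsGreatest (cellDim '' pointedFan d n) (dim d n) := by
  have hne : (cellDim '' pointedFan d n).Nonempty := by
    refine Set.Nonempty.image _ ⟨_, _, ⟨0, ?_, rfl⟩, rfl⟩
    intro R
    refine ⟨0, ?_, 1, ?_, by decide⟩ <;>
    · intro s
      fin_cases s <;> simp [ThreeTerm.termWeight]
  have hbd : BddAbove (cellDim '' pointedFan d n) := by
    refine ⟨(Module.finrank ℝ (Weight d n ⧸ lineality d n) : ℤ), ?_⟩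
    rintro _ ⟨C, -, rfl⟩
    have := Submodule.finrank_le (Submodule.span ℝ C)
    unfold cellDim
    omega
  exact ⟨Int.csSup_mem hne hbd, fun _ h => le_csSup hbd h⟩

end Dressian

end

/-! Upper bound. The cone of `w` lies in the linear space `initialSpace w`, whose dimension is the
rank of its coordinate functionals. In each three term relation two of the three sums of these
functionals coincide. Enlarge the ground set one point at a time: modulo the functionals of triples
in `T`, those of the triples `{i, j, x}` colour the edges `ij` of the complete graph on `T`, and the
relations say that each vertex sees at most two colours. Such a colouring has at most `T.card - 1`
colours (`card_colors_lt`), so the rank grows quadratically; subtracting the lineality dimension `n`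
gives the bound.

Lower bound. If any two triples of `N` share at most one element, then on nonnegative vectors with
support `N` at most one term of each relation is nonzero. These vectors therefore lie in the
relative interior of one cone, of dimension at least `N.card` modulo lineality. Triples with a fixed
sum modulo `n` form such a family, and some residue gives at least `n.choose 3 / n` of them. -/

open Module Submodule

namespace Dressian

/-! ### Edge colourings of complete graphs with few colours at each vertex. -/

section Coloring

variable {V α : Type*} [DecidableEq α]

/-- The colours that a colouring of pairs uses on the pairs of distinct elements of `T`. -/
def colors (c : V → V → α) (T : Finset V) : Finset α :=
  T.offDiag.image fun p => c p.1 p.2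

theorem mem_colors {c : V → V → α} {T : Finset V} {a : α} :
    a ∈ colors c T ↔ ∃ x ∈ T, ∃ y ∈ T, x ≠ y ∧ c x y = a := by
  simp only [colors, Finset.mem_image, Finset.mem_offDiag, Prod.exists]
  grind

/-- A Gallai colouring (one without rainbow triangles) of a complete graph uses fewer colours than
there are vertices. -/
theorem card_colors_lt_of_gallai [DecidableEq V] {c : V → V → α} (hc : ∀ x y, c x y = c y x)
    {T : Finset V} (hT : T.Nonempty)
    (h : ∀ x ∈ T, ∀ y ∈ T, ∀ z ∈ T, x ≠ y → x ≠ z → y ≠ z →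
      c x y = c x z ∨ c x y = c y z ∨ c x z = c y z) :
    (colors c T).card + 1 ≤ T.card := by
  induction hT using Finset.Nonempty.cons_induction with
  | singleton a => simp [colors]
  | cons x T hx hT ih =>
    have ih' := ih fun a ha b hb d hd => h a (by simp [ha]) b (by simp [hb]) d (by simp [hd])
    have hsub : colors c (Finset.cons x T hx) ⊆ colors c T ∪ (T.image (c x) \ colors c T) := by
      intro a ha
      rw [mem_colors] at ha
      obtain ⟨y, hy, z, hz, hyz, rfl⟩ := ha
      rw [Finset.union_sdiff_self_eq_union, Finset.mem_union, mem_colors, Finset.mem_image]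
      rw [Finset.mem_cons] at hy hz
      grind
    -- Two different new colours on `xy` and `xz` would make `xyz` rainbow, since `yz` has an old
    -- colour.
    have hone : (T.image (c x) \ colors c T).card ≤ 1 := by
      rw [Finset.card_le_one]
      intro a ha b hb
      simp only [Finset.mem_sdiff, Finset.mem_image, mem_colors] at ha hb
      obtain ⟨⟨y, hy, rfl⟩, hay⟩ := ha
      obtain ⟨⟨z, hz, rfl⟩, hbz⟩ := hb
      by_cases hyz : y = z
      · rw [hyz]
      · have := h x (by simp) y (by simp [hy]) z (by simp [hz]) (by grind) (by grind) hyz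
        grind
    have := (Finset.card_le_card hsub).trans (Finset.card_union_le _ _)
    rw [Finset.card_cons]
    omega

/-- If each vertex of a complete graph with at least four vertices sees at most two colours, then
there are fewer colours than vertices. -/
theorem card_colors_lt [DecidableEq V] {c : V → V → α} (hc : ∀ x y, c x y = c y x) {T : Finset V}
    (hT : 4 ≤ T.card)
    (h : ∀ s ∈ T, ∀ i ∈ T, ∀ j ∈ T, ∀ k ∈ T, s ≠ i → s ≠ j → s ≠ k → i ≠ j → i ≠ k → j ≠ k →
      c s i = c s j ∨ c s i = c s k ∨ c s j = c s k) :
    (colors c T).card + 1 ≤ T.card := by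
  by_cases hg : ∀ x ∈ T, ∀ y ∈ T, ∀ z ∈ T, x ≠ y → x ≠ z → y ≠ z →
      c x y = c x z ∨ c x y = c y z ∨ c x z = c y z
  · exact card_colors_lt_of_gallai hc (Finset.card_pos.mp (by omega)) hg
  push Not at hg
  obtain ⟨x, hx, y, hy, z, hz, hxy, hxz, hyz, h1, h2, h3⟩ := hg
  -- Each vertex of a rainbow triangle already sees two colours, so its other edges repeat them; the
  -- triangle's three colours are then all there are.
  have hsub : colors c T ⊆ {c x y, c x z, c y z} := by
    have hX : ∀ w ∈ T, w ≠ x → w ≠ y → w ≠ z → c w x = c x y ∨ c w x = c x z := by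
      intro w hw wx wy wz
      have := h x hx y hy z hz w hw hxy hxz wx.symm hyz wy.symm wz.symm
      have := hc w x
      grind
    have hY : ∀ w ∈ T, w ≠ x → w ≠ y → w ≠ z → c w y = c x y ∨ c w y = c y z := by
      intro w hw wx wy wz
      have := h y hy x hx z hz w hw hxy.symm hyz wy.symm hxz wx.symm wz.symm
      have := hc w y
      have := hc x y
      grind
    have hZ : ∀ w ∈ T, w ≠ x → w ≠ y → w ≠ z → c w z = c x z ∨ c w z = c y z := by
      intro w hw wx wy wz
      have := h z hz x hx y hy w hw hxz.symm hyz.symm wz.symm hxy wx.symm wy.symm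
      have := hc w z
      have := hc x z
      have := hc y z
      grind
    -- No colour occurs at all three of `x`, `y`, `z` in the triangle, so `w` sees two triangle
    -- colours on its edges to them, and `wu` must repeat one.
    have hW : ∀ w ∈ T, w ≠ x → w ≠ y → w ≠ z → ∀ u ∈ T, u ≠ x → u ≠ y → u ≠ z → w ≠ u →
        c w u = c x y ∨ c w u = c x z ∨ c w u = c y z := by
      intro w hw wx wy wz u hu ux uy uz wu
      have e1 := h w hw x hx y hy u hu wx wy wu hxy ux.symm uy.symm
      have e2 := h w hw x hx z hz u hu wx wz wu hxz ux.symm uz.symm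
      have e3 := h w hw y hy z hz u hu wy wz wu hyz uy.symm uz.symm
      have := hX w hw wx wy wz
      have := hY w hw wx wy wz
      have := hZ w hw wx wy wz
      clear hX hY hZ h
      grind
    intro a ha
    rw [mem_colors] at ha
    obtain ⟨p, hp, q, hq, hpq, rfl⟩ := ha
    simp only [Finset.mem_insert, Finset.mem_singleton]
    have := hX p hp
    have := hX q hq
    have := hY p hp
    have := hY q hq
    have := hZ p hp
    have := hZ q hq
    have := hW p hp
    have := hW q hq
    clear h hX hY hZ hW
    by_cases px : p = x <;> by_cases py : p = y <;> by_cases pz : p = z <;>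
      by_cases qx : q = x <;> by_cases qy : q = y <;> by_cases qz : q = z <;> grind
  have := (Finset.card_le_card hsub).trans Finset.card_le_three
  omega

end Coloring

/-! ### Upper bound through the rank of the coordinate functionals. -/

section UpperBound

variable {V M : Type*} [DecidableEq V] [AddCommGroup M] [Module ℝ M]

/-- The span of the vectors `φ X` for the triples `X` in `T`. -/
def tripleSpan (φ : Finset V → M) (T : Finset V) : Submodule ℝ M :=
  span ℝ (φ '' (T.powersetCard 3 : Finset (Finset V)))

/-- Two of the three sums of a three term relation agree, for all relations. -/
def TwoTermsAgree (φ : Finset V → M) : Prop :=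
  ∀ s i j k l, s ≠ i → s ≠ j → s ≠ k → s ≠ l → i ≠ j → i ≠ k → i ≠ l → j ≠ k → j ≠ l → k ≠ l →
    φ {s, i, j} + φ {s, k, l} = φ {s, i, k} + φ {s, j, l} ∨
    φ {s, i, j} + φ {s, k, l} = φ {s, i, l} + φ {s, j, k} ∨
    φ {s, i, k} + φ {s, j, l} = φ {s, i, l} + φ {s, j, k}

theorem mem_tripleSpan (φ : Finset V → M) {T : Finset V} {i j k : V} (hi : i ∈ T) (hj : j ∈ T)
    (hk : k ∈ T) (hij : i ≠ j) (hik : i ≠ k) (hjk : j ≠ k) : φ {i, j, k} ∈ tripleSpan φ T := by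
  refine subset_span ⟨_, ?_, rfl⟩
  rw [Finset.mem_coe, Finset.mem_powersetCard]
  refine ⟨?_, Finset.card_eq_three.mpr ⟨i, j, k, hij, hik, hjk, rfl⟩⟩
  intro a
  simp only [Finset.mem_insert, Finset.mem_singleton]
  grind

/-- In the relation on `s` and `i, j, k, x`, each sum has one triple inside `T`, which vanishes
modulo `W`. What remains is that two of `c s i`, `c s j`, `c s k` agree. Lifts of the colours span
the new part. -/
theorem finrank_tripleSpan_insert_le [FiniteDimensional ℝ M] {φ : Finset V → M}
    (hφ : TwoTermsAgree φ) {T : Finset V} (hT : 4 ≤ T.card) {x : V} (hx : x ∉ T) :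
    finrank ℝ (tripleSpan φ (insert x T)) + 1 ≤ finrank ℝ (tripleSpan φ T) + T.card := by
  classical
  set W := tripleSpan φ T with hW
  let c : V → V → M ⧸ W := fun i j => W.mkQ (φ {i, j, x})
  have hc : ∀ i j, c i j = c j i := fun i j => by
    simp only [c, Finset.insert_comm i j]
  have hcard : (colors c T).card + 1 ≤ T.card := by
    refine card_colors_lt hc hT ?_
    intro s hs i hi j hj k hk si sj sk ij ik jk
    have hne : ∀ {a}, a ∈ T → a ≠ x := fun ha h => hx (h ▸ ha)
    have z1 : W.mkQ (φ {s, i, j}) = 0 :=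
      (Quotient.mk_eq_zero W).mpr (mem_tripleSpan φ hs hi hj si sj ij)
    have z2 : W.mkQ (φ {s, i, k}) = 0 :=
      (Quotient.mk_eq_zero W).mpr (mem_tripleSpan φ hs hi hk si sk ik)
    have z3 : W.mkQ (φ {s, j, k}) = 0 :=
      (Quotient.mk_eq_zero W).mpr (mem_tripleSpan φ hs hj hk sj sk jk)
    rcases hφ s i j k x si sj sk (hne hs) ij ik (hne hi) jk (hne hj) (hne hk) with h | h | h
    all_goals
      have h' := congrArg W.mkQ h
      simp only [map_add, z1, z2, z3, zero_add, add_zero] at h'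
    · exact Or.inr (Or.inr h'.symm)
    · exact Or.inr (Or.inl h'.symm)
    · exact Or.inl h'.symm
  let D : Finset M := (colors c T).image Quotient.out
  have hle : tripleSpan φ (insert x T) ≤ W ⊔ span ℝ (D : Set M) := by
    refine span_le.mpr ?_
    rintro _ ⟨X, hX, rfl⟩
    rw [Finset.mem_coe, Finset.mem_powersetCard] at hX
    obtain ⟨hXs, hX3⟩ := hX
    by_cases hxX : x ∈ X
    · obtain ⟨i, j, hij, he⟩ := Finset.card_eq_two.mp
        (show (X.erase x).card = 2 by rw [Finset.card_erase_of_mem hxX, hX3])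
      have hXe : X = {i, j, x} := by
        rw [← Finset.insert_erase hxX, he]
        ext a
        simp only [Finset.mem_insert, Finset.mem_singleton]
        tauto
      have hmem : ∀ a ∈ X.erase x, a ∈ T := fun a ha =>
        (Finset.mem_insert.mp (hXs (Finset.mem_of_mem_erase ha))).resolve_left
          (Finset.ne_of_mem_erase ha)
      have hcol : c i j ∈ colors c T :=
        mem_colors.mpr ⟨i, hmem i (by simp [he]), j, hmem j (by simp [he]), hij, rfl⟩
      have hD : (c i j).out ∈ span ℝ (D : Set M) :=
        subset_span (Finset.mem_coe.mpr (Finset.mem_image_of_mem _ hcol))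
      have hdiff : φ X - (c i j).out ∈ W := by
        rw [← Submodule.Quotient.eq, hXe]
        exact (Quotient.out_eq (c i j)).symm
      have := add_mem (mem_sup_left (T := span ℝ (D : Set M)) hdiff) (mem_sup_right (S := W) hD)
      simpa using this
    · refine mem_sup_left (subset_span ⟨X, ?_, rfl⟩)
      rw [Finset.mem_coe, Finset.mem_powersetCard]
      exact ⟨(Finset.subset_insert_iff_of_notMem hxX).mp hXs, hX3⟩
  have h1 := Submodule.finrank_mono hle
  have h2 := Submodule.finrank_add_le_finrank_add_finrank W (span ℝ (D : Set M))
  have h3 : finrank ℝ (span ℝ (D : Set M)) ≤ D.card := finrank_span_finset_le_card D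
  have h4 : D.card ≤ (colors c T).card := Finset.card_image_le
  omega

theorem finrank_tripleSpan_le [FiniteDimensional ℝ M] {φ : Finset V → M} (hφ : TwoTermsAgree φ)
    (m : ℕ) (T : Finset V) (hT : T.card = m + 4) :
    finrank ℝ (tripleSpan φ T) ≤ (m + 4) + (m + 2).choose 2 := by
  classical
  induction m generalizing T with
  -- Four triples give rank at most 4; the closed form allows 5.
  | zero =>
    have h : finrank ℝ (tripleSpan φ T) ≤ ((T.powersetCard 3).image φ).card := by
      rw [tripleSpan, ← Finset.coe_image]
      exact finrank_span_finset_le_card _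
    have h' : ((T.powersetCard 3).image φ).card ≤ 4 :=
      Finset.card_image_le.trans (by rw [Finset.card_powersetCard, hT]; decide)
    exact (h.trans h').trans (by omega)
  | succ m ih =>
    obtain ⟨x, U, hxU, rfl, hU⟩ := Finset.card_eq_succ.mp hT
    have h1 := finrank_tripleSpan_insert_le hφ (T := U) (by omega) hxU
    have h2 := ih U hU
    have h3 : (m + 1 + 2).choose 2 = (m + 2) + (m + 2).choose 2 := by
      rw [Nat.choose_succ_succ' (m + 2) 1, Nat.choose_one_right]
    omega

/-- The linear space of all vectors for which the terms of each three term relation that are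
minimal at `w` agree. -/
def initialSpace {d n : ℕ} (w : Weight d n) : Submodule ℝ (Weight d n) where
  carrier := {v | ∀ R : ThreeTerm d n, ∀ s ∈ R.initialTerms w, ∀ t ∈ R.initialTerms w,
    R.termWeight v s = R.termWeight v t}
  zero_mem' := by
    intro R s _ t _
    fin_cases s <;> fin_cases t <;> simp [ThreeTerm.termWeight]
  add_mem' := by
    intro u v hu hv R s hs t ht
    have hadd : ∀ t, R.termWeight (u + v) t = R.termWeight u t + R.termWeight v t := by
      intro t
      fin_cases t <;> simp [ThreeTerm.termWeight] <;> ring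
    rw [hadd, hadd, hu R s hs t ht, hv R s hs t ht]
  smul_mem' := by
    intro a v hv R s hs t ht
    have hsmul : ∀ t, R.termWeight (a • v) t = a * R.termWeight v t := by
      intro t
      fin_cases t <;> simp [ThreeTerm.termWeight] <;> ring
    rw [hsmul, hsmul, hv R s hs t ht]

theorem pluckerCone_subset {d n : ℕ} (w : Weight d n) : pluckerCone w ⊆ initialSpace w := by
  refine closure_minimal ?_ (Submodule.closed_of_finiteDimensional _)
  intro v hv R s hs t ht
  rw [← hv R] at hs ht
  exact le_antisymm (hs t) (ht s)

theorem lineality_le_initialSpace {d n : ℕ} (w : Weight d n) : lineality d n ≤ initialSpace w := by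
  rintro _ ⟨a, rfl⟩ R s _ t _
  have hsum : ∀ p q (h : p ≠ q), ∑ i ∈ (R.idx p q h).1, a i
      = a (R.e p) + (a (R.e q) + ∑ i ∈ R.S, a i) := by
    intro p q h
    rw [ThreeTerm.idx, Finset.sum_insert (by simp [R.notMem_S p, h]),
      Finset.sum_insert (R.notMem_S q)]
  fin_cases s <;> fin_cases t <;> simp [ThreeTerm.termWeight, hsum] <;> ring

/-- The relation with `S = {s}` and the elements `i`, `j`, `k`, `l`. -/
def ThreeTerm.ofElements {n : ℕ} (s i j k l : Fin n) (si : s ≠ i) (sj : s ≠ j) (sk : s ≠ k)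
    (sl : s ≠ l) (ij : i ≠ j) (ik : i ≠ k) (il : i ≠ l) (jk : j ≠ k) (jl : j ≠ l) (kl : k ≠ l) :
    ThreeTerm 3 n where
  S := {s}
  e := ⟨![i, j, k, l], by
    intro a b hab
    fin_cases a <;> fin_cases b <;> simp_all⟩
  card_S := by simp
  notMem_S := by
    intro a
    rw [Finset.mem_singleton]
    fin_cases a
    exacts [si.symm, sj.symm, sk.symm, sl.symm]

theorem finrank_initialSpace_le {n : ℕ} (hn : 4 ≤ n) {w : Weight 3 n} (hw : w ∈ dressian 3 n) :
    finrank ℝ (initialSpace w) ≤ n + (n - 2).choose 2 := by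
  let φ : Finset (Fin n) → Dual ℝ (initialSpace w) := fun X =>
    if h : X.card = 3 then (LinearMap.proj (⟨X, h⟩ : Subsets 3 n)).comp (initialSpace w).subtype
    else 0
  have hφX : ∀ (X : Subsets 3 n) (v : initialSpace w), φ X.1 v = v.1 X := by
    intro X v
    simp [φ, X.2]
  have hφ : TwoTermsAgree φ := by
    intro s i j k l si sj sk sl ij ik il jk jl kl
    let R := ThreeTerm.ofElements s i j k l si sj sk sl ij ik il jk jl kl
    have hidx : ∀ p q (h : p ≠ q) (v : initialSpace w),
        v.1 (R.idx p q h) = φ {s, R.e p, R.e q} v := by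
      intro p q h v
      rw [← hφX]
      congr 2
      change insert (R.e p) (insert (R.e q) {s}) = _
      ext a
      simp only [Finset.mem_insert, Finset.mem_singleton]
      tauto
    have hterm : ∀ v : initialSpace w, R.termWeight v.1 =
        ![(φ {s, i, j} + φ {s, k, l}) v, (φ {s, i, k} + φ {s, j, l}) v,
          (φ {s, i, l} + φ {s, j, k}) v] := by
      intro v
      simp only [ThreeTerm.termWeight, hidx]
      rfl
    obtain ⟨p, hp, q, hq, hpq⟩ := hw R
    have key : ∀ v : initialSpace w, R.termWeight v.1 p = R.termWeight v.1 q :=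
      fun v => v.2 R p hp q hq
    simp only [hterm] at key
    fin_cases p <;> fin_cases q <;> first
      | exact absurd rfl hpq
      | exact Or.inl (LinearMap.ext fun v => key v)
      | exact Or.inl (LinearMap.ext fun v => (key v).symm)
      | exact Or.inr (Or.inl (LinearMap.ext fun v => key v))
      | exact Or.inr (Or.inl (LinearMap.ext fun v => (key v).symm))
      | exact Or.inr (Or.inr (LinearMap.ext fun v => key v))
      | exact Or.inr (Or.inr (LinearMap.ext fun v => (key v).symm))
  obtain ⟨m, rfl⟩ : ∃ m, n = m + 4 := ⟨n - 4, by omega⟩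
  have hle := finrank_tripleSpan_le hφ m Finset.univ (by simp)
  -- The coordinates separate points, so they span the whole dual.
  have hbot : (tripleSpan φ Finset.univ).dualCoannihilator = ⊥ := by
    rw [eq_bot_iff]
    intro v hv
    rw [mem_dualCoannihilator] at hv
    rw [Submodule.mem_bot]
    ext X
    rw [← hφX X v]
    exact hv _ (subset_span ⟨X.1, by simp [X.2], rfl⟩)
  have hdim := Subspace.finrank_add_finrank_dualCoannihilator_eq (tripleSpan φ Finset.univ)
  rw [hbot, finrank_bot] at hdim
  have hsub : m + 4 - 2 = m + 2 := by omega
  rw [hsub]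
  omega

theorem exists_pair_ne_ne {n : ℕ} (hn : 4 ≤ n) (i j : Fin n) :
    ∃ k l : Fin n, k ≠ l ∧ k ≠ i ∧ k ≠ j ∧ l ≠ i ∧ l ≠ j := by
  have hcard : 1 < (Finset.univ \ {i, j} : Finset (Fin n)).card := by
    have h1 := Finset.le_card_sdiff {i, j} (Finset.univ : Finset (Fin n))
    have h2 : ({i, j} : Finset (Fin n)).card ≤ 2 := Finset.card_le_two
    rw [Finset.card_univ, Fintype.card_fin] at h1
    omega
  obtain ⟨k, hk, l, hl, hkl⟩ := Finset.one_lt_card.mp hcard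
  simp at hk hl
  exact ⟨k, l, hkl, hk.1, hk.2, hl.1, hl.2⟩

theorem finrank_lineality {n : ℕ} (hn : 4 ≤ n) : finrank ℝ (lineality 3 n) = n := by
  rw [lineality, LinearMap.finrank_range_of_inj, finrank_fin_fun]
  rw [← LinearMap.ker_eq_bot, eq_bot_iff]
  intro a ha
  have hsum : ∀ i k l : Fin n, i ≠ k → i ≠ l → k ≠ l → a i + (a k + a l) = 0 := by
    intro i k l hik hil hkl
    have := congrFun ha ⟨{i, k, l}, Finset.card_eq_three.mpr ⟨i, k, l, hik, hil, hkl, rfl⟩⟩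
    simpa [hik, hil, hkl] using this
  rw [Submodule.mem_bot]
  ext i
  obtain ⟨k, l, hkl, hki, -, hli, -⟩ := exists_pair_ne_ne hn i i
  have heq : ∀ j, a i = a j := by
    intro j
    obtain ⟨k, l, hkl, hki, hkj, hli, hlj⟩ := exists_pair_ne_ne hn i j
    have h1 := hsum i k l hki.symm hli.symm hkl
    have h2 := hsum j k l hkj.symm hlj.symm hkl
    linarith
  have h1 := hsum i k l hki.symm hli.symm hkl
  have h2 := heq k
  have h3 := heq l
  rw [Pi.zero_apply]
  linarith

theorem finrank_map_mkQ_add {V : Type*} [AddCommGroup V] [Module ℝ V] [FiniteDimensional ℝ V]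
    {P L : Submodule ℝ V} (h : P ≤ L) : finrank ℝ (L.map P.mkQ) + finrank ℝ P = finrank ℝ L := by
  have h1 := (P.mkQ.domRestrict L).finrank_range_add_finrank_ker
  rw [LinearMap.range_domRestrict, LinearMap.ker_domRestrict, ker_mkQ] at h1
  rwa [(comapSubtypeEquivOfLe h).finrank_eq] at h1

theorem dim_le {n : ℕ} (hn : 3 ≤ n) : dim 3 n ≤ ((n - 2).choose 2 : ℤ) - 1 := by
  obtain ⟨_, ⟨_, ⟨w, hw, rfl⟩, rfl⟩, h⟩ := (isGreatest_dim 3 n).1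
  rw [← h, cellDim, span_image]
  have hspan : span ℝ (pluckerCone w) ≤ initialSpace w := span_le.mpr (pluckerCone_subset w)
  have hmono := Submodule.finrank_mono (Submodule.map_mono (f := (lineality 3 n).mkQ) hspan)
  have hadd := finrank_map_mkQ_add (lineality_le_initialSpace w)
  obtain rfl | hn := hn.eq_or_lt
  -- For `n = 3` the ambient space is a line and equals the lineality space.
  · have h1 : finrank ℝ (lineality 3 3) ≠ 0 := by
      intro h0
      rw [Submodule.finrank_eq_zero] at h0
      have : (LinearMap.pi fun X : Subsets 3 3 =>
          ∑ i ∈ X.1, LinearMap.proj (R := ℝ) (φ := fun _ => ℝ) i) (fun _ => (1 : ℝ))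
            ∈ lineality 3 3 := ⟨_, rfl⟩
      rw [h0, Submodule.mem_bot] at this
      have := congrFun this ⟨Finset.univ, by simp⟩
      simp at this
    have h2 : finrank ℝ (initialSpace w) ≤ 1 := by
      refine (Submodule.finrank_le _).trans ?_
      rw [finrank_fintype_fun_eq_card, Fintype.card_finset_len]
      simp
    have h3 : (3 - 2).choose 2 = 0 := by decide
    omega
  · have h1 := finrank_initialSpace_le hn hw
    rw [finrank_lineality hn] at hadd
    omega

end UpperBound

/-! ### Lower bound from packings of triples. -/

section LowerBound

variable {n : ℕ}

/-- A family of triples any two of which have at most one element in common. -/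
def IsPacking (N : Finset (Subsets 3 n)) : Prop :=
  ∀ X ∈ N, ∀ Y ∈ N, ∀ p q, p ≠ q → p ∈ X.1 → q ∈ X.1 → p ∈ Y.1 → q ∈ Y.1 → X = Y

/-- The nonnegative vectors with support `N`. -/
def HasSupport (N : Finset (Subsets 3 n)) (v : Weight 3 n) : Prop :=
  (∀ X, 0 ≤ v X) ∧ ∀ X, v X = 0 ↔ X ∉ N

theorem ThreeTerm.idx_comm {d : ℕ} (R : ThreeTerm d n) (a b : Fin 4) (h : a ≠ b) :
    R.idx a b h = R.idx b a h.symm :=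
  Subtype.ext (Finset.insert_comm _ _ _)

/-- Both triples contain `R.e a` and the single element of `R.S`. -/
theorem IsPacking.idx_notMem {N : Finset (Subsets 3 n)} (hN : IsPacking N) (R : ThreeTerm 3 n)
    {a b c : Fin 4} (hab : a ≠ b) (hac : a ≠ c) (hbc : b ≠ c) (h : R.idx a b hab ∈ N) :
    R.idx a c hac ∉ N := by
  intro h'
  obtain ⟨s, hs⟩ := Finset.card_eq_one.mp (show R.S.card = 1 by have := R.card_S; omega)
  have hsS : s ∈ R.S := by simp [hs]
  have heq := hN _ h _ h' (R.e a) s (fun he => R.notMem_S a (he ▸ hsS))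
    (by simp [ThreeTerm.idx]) (by simp [ThreeTerm.idx, hsS]) (by simp [ThreeTerm.idx]) (by simp [ThreeTerm.idx, hsS])
  have hb : R.e b ∈ (R.idx a c hac).1 := by
    rw [← heq]
    simp [ThreeTerm.idx]
  simp [ThreeTerm.idx, R.notMem_S b, hab.symm, hbc] at hb

/-- All but one of the terms of a relation vanish on vectors that are supported on a packing. -/
theorem HasSupport.exists_termWeight {N : Finset (Subsets 3 n)} (hN : IsPacking N)
    {v : Weight 3 n} (hv : HasSupport N v) (R : ThreeTerm 3 n) :
    ∃ t₀, ∀ t, t ≠ t₀ → R.termWeight v t = 0 := by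
  have hz : ∀ {a b c : Fin 4} (hab : a ≠ b) (hac : a ≠ c), b ≠ c → R.idx a b hab ∈ N →
      v (R.idx a c hac) = 0 := fun hab hac hbc h => (hv.2 _).mpr (hN.idx_notMem R hab hac hbc h)
  by_cases h01 : R.idx 0 1 (by decide) ∈ N
  · refine ⟨0, fun t ht => ?_⟩
    have h10 := h01
    rw [R.idx_comm] at h10
    have e1 := hz _ (show (0 : Fin 4) ≠ 2 by decide) (by decide) h01
    have e2 := hz _ (show (0 : Fin 4) ≠ 3 by decide) (by decide) h01
    have e3 := hz _ (show (1 : Fin 4) ≠ 2 by decide) (by decide) h10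
    have e4 := hz _ (show (1 : Fin 4) ≠ 3 by decide) (by decide) h10
    fin_cases t <;> simp_all [ThreeTerm.termWeight]
  by_cases h23 : R.idx 2 3 (by decide) ∈ N
  · refine ⟨0, fun t ht => ?_⟩
    have h32 := h23
    rw [R.idx_comm] at h32
    have e1 := hz _ (show (2 : Fin 4) ≠ 0 by decide) (by decide) h23
    have e2 := hz _ (show (2 : Fin 4) ≠ 1 by decide) (by decide) h23
    have e3 := hz _ (show (3 : Fin 4) ≠ 0 by decide) (by decide) h32
    have e4 := hz _ (show (3 : Fin 4) ≠ 1 by decide) (by decide) h32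
    rw [R.idx_comm] at e1 e2 e3 e4
    fin_cases t <;> simp_all [ThreeTerm.termWeight]
  have z1 := (hv.2 _).mpr h01
  have z2 := (hv.2 _).mpr h23
  by_cases h02 : R.idx 0 2 (by decide) ∈ N
  · refine ⟨1, fun t ht => ?_⟩
    have h20 := h02
    rw [R.idx_comm] at h20
    have e1 := hz _ (show (0 : Fin 4) ≠ 3 by decide) (by decide) h02
    have e2 := hz _ (show (2 : Fin 4) ≠ 1 by decide) (by decide) h20
    rw [R.idx_comm] at e2
    fin_cases t <;> simp_all [ThreeTerm.termWeight]
  by_cases h13 : R.idx 1 3 (by decide) ∈ N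
  · refine ⟨1, fun t ht => ?_⟩
    have h31 := h13
    rw [R.idx_comm] at h31
    have e1 := hz _ (show (1 : Fin 4) ≠ 2 by decide) (by decide) h13
    have e2 := hz _ (show (3 : Fin 4) ≠ 0 by decide) (by decide) h31
    rw [R.idx_comm] at e2
    fin_cases t <;> simp_all [ThreeTerm.termWeight]
  have z3 := (hv.2 _).mpr h02
  have z4 := (hv.2 _).mpr h13
  refine ⟨2, fun t ht => ?_⟩
  fin_cases t <;> simp_all [ThreeTerm.termWeight]

theorem HasSupport.initialTerms_eq {N : Finset (Subsets 3 n)} (hN : IsPacking N)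
    {v : Weight 3 n} (hv : HasSupport N v) (R : ThreeTerm 3 n) :
    R.initialTerms v = {t | R.termWeight v t = 0} := by
  have hnn : ∀ t, 0 ≤ R.termWeight v t := by
    intro t
    fin_cases t <;> exact add_nonneg (hv.1 _) (hv.1 _)
  obtain ⟨t₀, ht₀⟩ := hv.exists_termWeight hN R
  obtain ⟨t₁, ht₁⟩ := exists_ne t₀
  ext t
  refine ⟨fun h => le_antisymm ((h t₁).trans_eq (ht₀ t₁ ht₁)) (hnn t), fun h s => ?_⟩
  rw [show R.termWeight v t = 0 from h]
  exact hnn s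

theorem HasSupport.initialTerms_congr {N : Finset (Subsets 3 n)} (hN : IsPacking N)
    {u v : Weight 3 n} (hu : HasSupport N u) (hv : HasSupport N v) (R : ThreeTerm 3 n) :
    R.initialTerms u = R.initialTerms v := by
  rw [hu.initialTerms_eq hN, hv.initialTerms_eq hN]
  have hX : ∀ X Y, u X + u Y = 0 ↔ v X + v Y = 0 := fun X Y => by
    rw [add_eq_zero_iff_of_nonneg (hu.1 X) (hu.1 Y), add_eq_zero_iff_of_nonneg (hv.1 X) (hv.1 Y),
      hu.2, hu.2, hv.2, hv.2]
  ext t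
  fin_cases t <;> exact hX _ _

theorem HasSupport.mem_dressian {N : Finset (Subsets 3 n)} (hN : IsPacking N)
    {v : Weight 3 n} (hv : HasSupport N v) : v ∈ dressian 3 n := by
  intro R
  rw [hv.initialTerms_eq hN]
  obtain ⟨t₀, ht₀⟩ := hv.exists_termWeight hN R
  -- Addition in `Fin 3` is cyclic: these are the two indices other than `t₀`.
  refine ⟨t₀ + 1, ht₀ _ (by fin_cases t₀ <;> decide), t₀ + 2,
    ht₀ _ (by fin_cases t₀ <;> decide), by fin_cases t₀ <;> decide⟩

/-- A vector in the lineality space that is supported on a packing vanishes. -/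
theorem IsPacking.eq_zero_of_mem_lineality (hn : 5 ≤ n) {N : Finset (Subsets 3 n)}
    (hN : IsPacking N) {v : Weight 3 n} (hv : v ∈ lineality 3 n) (h0 : ∀ X, X ∉ N → v X = 0) :
    v = 0 := by
  obtain ⟨a, rfl⟩ := hv
  let B : Fin n → Fin n → Fin n → Prop := fun i k l => ∃ X ∈ N, X.1 = {i, k, l}
  have hsum : ∀ i k l, i ≠ k → i ≠ l → k ≠ l → ¬ B i k l → a i + (a k + a l) = 0 := by
    intro i k l hik hil hkl h
    have := h0 ⟨{i, k, l}, Finset.card_eq_three.mpr ⟨i, k, l, hik, hil, hkl, rfl⟩⟩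
      fun hN => h ⟨_, hN, rfl⟩
    simpa [hik, hil, hkl] using this
  have hcomm : ∀ i k l, B i k l → B i l k := fun i k l ⟨X, hX, he⟩ =>
    ⟨X, hX, by rw [he, Finset.pair_comm]⟩
  have hmeet : ∀ x y p q, x ≠ y → x ≠ p → y ≠ p → p ≠ q → ¬ (B x y p ∧ B x y q) := by
    rintro x y p q hxy hxp hyp hpq ⟨⟨X, hX, hXe⟩, Y, hY, hYe⟩
    have := hN X hX Y hY x y hxy (by simp [hXe]) (by simp [hXe]) (by simp [hYe]) (by simp [hYe])
    have hp : p ∈ Y.1 := by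
      rw [← this, hXe]
      simp
    rw [hYe] at hp
    simp [hxp.symm, hyp.symm, hpq] at hp
  have hpair : ∀ i j : Fin n, ∃ k l, a i + (a k + a l) = 0 ∧ a j + (a k + a l) = 0 := by
    intro i j
    have hcard : 2 < (Finset.univ \ {i, j} : Finset (Fin n)).card := by
      have h1 := Finset.le_card_sdiff {i, j} (Finset.univ : Finset (Fin n))
      have h2 : ({i, j} : Finset (Fin n)).card ≤ 2 := Finset.card_le_two
      rw [Finset.card_univ, Fintype.card_fin] at h1
      omega
    obtain ⟨k, hk, l, hl, m, hm, hkl, hkm, hlm⟩ := Finset.two_lt_card.mp hcard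
    simp only [Finset.mem_sdiff, Finset.mem_univ, Finset.mem_insert, Finset.mem_singleton,
      true_and, not_or] at hk hl hm
    -- The triples `xkl`, `xkm`, `xlm` pairwise share two elements, so at most one is in `N`. Two of
    -- the three equations thus hold for `i` and two for `j`, hence one holds for both.
    have hatmost : ∀ x : Fin n, k ≠ x → l ≠ x → m ≠ x →
        (a x + (a k + a l) = 0 ∧ a x + (a k + a m) = 0) ∨
        (a x + (a k + a l) = 0 ∧ a x + (a l + a m) = 0) ∨
        (a x + (a k + a m) = 0 ∧ a x + (a l + a m) = 0) := by
      intro x hkx hlx hmx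
      have s1 := hsum x k l hkx.symm hlx.symm hkl
      have s2 := hsum x k m hkx.symm hmx.symm hkm
      have s3 := hsum x l m hlx.symm hmx.symm hlm
      have b12 := hmeet x k l m hkx.symm hlx.symm hkl hlm
      have b13 := hmeet x l k m hlx.symm hkx.symm hkl.symm hkm
      have b23 := hmeet x m k l hmx.symm hkx.symm hkm.symm hkl
      by_cases h1 : B x k l
      · exact Or.inr (Or.inr ⟨s2 fun h => b12 ⟨h1, h⟩, s3 fun h => b13 ⟨hcomm x k l h1, h⟩⟩)
      by_cases h2 : B x k m
      · exact Or.inr (Or.inl ⟨s1 h1, s3 fun h => b23 ⟨hcomm x k m h2, hcomm x l m h⟩⟩)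
      exact Or.inl ⟨s1 h1, s2 h2⟩
    have hi := hatmost i hk.1 hl.1 hm.1
    have hj := hatmost j hk.2 hl.2 hm.2
    grind
  have heq : ∀ i j, a i = a j := by
    intro i j
    obtain ⟨k, l, h1, h2⟩ := hpair i j
    linarith
  have hzero : a = 0 := by
    ext i
    obtain ⟨k, l, h1, -⟩ := hpair i i
    rw [heq k i, heq l i] at h1
    rw [Pi.zero_apply]
    linarith
  rw [hzero, map_zero]

theorem IsPacking.card_le_dim (hn : 5 ≤ n) {N : Finset (Subsets 3 n)} (hN : IsPacking N) :
    (N.card : ℤ) - 1 ≤ dim 3 n := by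
  classical
  let w : Weight 3 n := fun X => if X ∈ N then 1 else 0
  have hw : HasSupport N w := by
    refine ⟨fun X => ?_, fun X => ?_⟩ <;> by_cases h : X ∈ N <;> simp [w, h]
  let Q := (lineality 3 n).mkQ
  have hle : cellDim (Q '' pluckerCone w) ≤ dim 3 n :=
    (isGreatest_dim 3 n).2 ⟨_, ⟨_, ⟨w, hw.mem_dressian hN, rfl⟩, rfl⟩, rfl⟩
  refine le_trans ?_ hle
  rw [cellDim, span_image]
  have hmem : ∀ X : N, (Pi.single X.1 1 : Weight 3 n) ∈ span ℝ (pluckerCone w) := by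
    intro X
    -- Raising one positive coordinate keeps the support, so the unit vector is a difference of two
    -- vectors of the cone.
    have hX : HasSupport N (w + Pi.single X.1 1) := by
      refine ⟨fun Y => ?_, fun Y => ?_⟩ <;> by_cases hY : Y = X.1
      · subst hY
        simp [w, X.2]
      · simpa [hY] using hw.1 Y
      · subst hY
        simp [w, X.2]
      · simpa [hY] using hw.2 Y
    have h1 : w + Pi.single X.1 1 ∈ span ℝ (pluckerCone w) :=
      subset_span (subset_closure fun R => hX.initialTerms_congr hN hw R)
    have h2 : w ∈ span ℝ (pluckerCone w) := subset_span (subset_closure fun R => rfl)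
    simpa using sub_mem h1 h2
  have hli : LinearIndependent ℝ fun X : N => Q (Pi.single X.1 1 : Weight 3 n) := by
    rw [Fintype.linearIndependent_iff]
    intro g hg X
    simp only [← map_smul, ← map_sum] at hg
    have hv := hN.eq_zero_of_mem_lineality hn ((Quotient.mk_eq_zero _).mp hg) (by
      intro Y hY
      rw [Finset.sum_apply]
      refine Finset.sum_eq_zero fun Z _ => ?_
      have hne : Y ≠ Z.1 := fun h => hY (h ▸ Z.2)
      simp [hne])
    have hX := congrFun hv X.1
    rw [Finset.sum_apply, Finset.sum_eq_single X] at hX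
    · simpa using hX
    · intro Z _ hZ
      have hne : X.1 ≠ Z.1 := fun h => hZ (Subtype.ext h.symm)
      simp [hne]
    · simp
  have hli' : LinearIndependent ℝ
      fun X : N => (⟨_, mem_map_of_mem (hmem X)⟩ : (span ℝ (pluckerCone w)).map Q) :=
    LinearIndependent.of_comp ((span ℝ (pluckerCone w)).map Q).subtype hli
  have := hli'.fintype_card_le_finrank
  rw [Fintype.card_coe] at this
  exact sub_le_sub_right (by exact_mod_cast this) 1

/-- The triples whose elements have sum `c` modulo `n`. -/
def sumPacking (n : ℕ) (c : ZMod n) : Finset (Subsets 3 n) :=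
  {X | ∑ i ∈ X.1, ((i : ℕ) : ZMod n) = c}

/-- Two elements and the sum determine the third modulo `n`, hence in `Fin n`. -/
theorem isPacking_sumPacking (c : ZMod n) : IsPacking (sumPacking n c) := by
  have hthird : ∀ X ∈ sumPacking n c, ∀ p q, p ≠ q → p ∈ X.1 → q ∈ X.1 →
      ∃ x, X.1 = {p, q, x} ∧ ((p : ℕ) : ZMod n) + (((q : ℕ) : ZMod n) + ((x : ℕ) : ZMod n)) = c := by
    intro X hX p q hpq hp hq
    have hq' : q ∈ X.1.erase p := Finset.mem_erase.mpr ⟨hpq.symm, hq⟩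
    obtain ⟨x, hx⟩ := Finset.card_eq_one.mp
      (show ((X.1.erase p).erase q).card = 1 by
        rw [Finset.card_erase_of_mem hq', Finset.card_erase_of_mem hp, X.2])
    refine ⟨x, by rw [← hx, Finset.insert_erase hq', Finset.insert_erase hp], ?_⟩
    have hs : ∑ i ∈ X.1, ((i : ℕ) : ZMod n) = c := by simpa [sumPacking] using hX
    rw [← hs, ← Finset.add_sum_erase _ _ hp, ← Finset.add_sum_erase _ _ hq', hx,
      Finset.sum_singleton]
  intro X hX Y hY p q hpq hpX hqX hpY hqY
  obtain ⟨x, hx, hxs⟩ := hthird X hX p q hpq hpX hqX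
  obtain ⟨y, hy, hys⟩ := hthird Y hY p q hpq hpY hqY
  have hxy : ((x : ℕ) : ZMod n) = ((y : ℕ) : ZMod n) :=
    add_left_cancel (add_left_cancel (hxs.trans hys.symm))
  rw [ZMod.natCast_eq_natCast_iff', Nat.mod_eq_of_lt x.2, Nat.mod_eq_of_lt y.2] at hxy
  ext1
  rw [hx, hy, Fin.ext hxy]

theorem exists_packing [NeZero n] :
    ∃ N : Finset (Subsets 3 n), IsPacking N ∧ n.choose 3 ≤ n * N.card := by
  obtain ⟨c, -, hc⟩ := Finset.exists_le_of_sum_le (s := (Finset.univ : Finset (ZMod n)))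
    (f := fun _ => n.choose 3) (g := fun c => n * (sumPacking n c).card)
    Finset.univ_nonempty (by
      have h : ∑ c : ZMod n, (sumPacking n c).card = Fintype.card (Subsets 3 n) := by
        rw [← Finset.card_univ]
        exact (Finset.card_eq_sum_card_fiberwise fun _ _ => Finset.mem_univ _).symm
      rw [← Finset.mul_sum, h, Fintype.card_finset_len, Fintype.card_fin]
      simp [ZMod.card])
  exact ⟨_, isPacking_sumPacking c, hc⟩

theorem le_dim (hn : 5 ≤ n) : (n : ℝ) ^ 2 / 24 - (n : ℝ) / 12 - 1 ≤ (dim 3 n : ℝ) := by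
  have : NeZero n := ⟨by omega⟩
  obtain ⟨N, hN, hcard⟩ := exists_packing (n := n)
  have hdim : (N.card : ℝ) - 1 ≤ (dim 3 n : ℝ) := by exact_mod_cast hN.card_le_dim hn
  have hchoose : (n.choose 3 : ℝ) = (n : ℝ) * (n - 1) * (n - 2) / 6 := by
    obtain ⟨m, rfl⟩ : ∃ m, n = m + 2 := ⟨n - 2, by omega⟩
    have h := Nat.descFactorial_eq_factorial_mul_choose (m + 2) 3
    simp only [Nat.descFactorial, Nat.factorial, Nat.add_sub_cancel, Nat.sub_zero,
      show m + 2 - 1 = m + 1 by omega] at h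
    have h' : ((m * ((m + 1) * ((m + 2) * 1)) : ℕ) : ℝ)
        = ((3 * (2 * (1 * 1)) * (m + 2).choose 3 : ℕ) : ℝ) := by exact_mod_cast h
    push_cast at h' ⊢
    linarith
  have hc : (n.choose 3 : ℝ) ≤ n * N.card := by exact_mod_cast hcard
  have h5 : (5 : ℝ) ≤ n := by exact_mod_cast hn
  have hle : ((n : ℝ) - 1) * (n - 2) / 6 ≤ N.card := by
    rw [hchoose] at hc
    refine le_of_mul_le_mul_left ?_ (show (0 : ℝ) < n by linarith)
    linarith
  -- The slack is `(n - 2) * (3 * n - 4) / 24`.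
  nlinarith

end LowerBound

end Dressian

theorem theorem3p6 :
    ((fun n : ℕ => (Dressian.dim 3 n : ℝ)) =Θ[atTop] fun n : ℕ => (n : ℝ) ^ 2) ∧
    (∀ n : ℕ, 3 ≤ n → Dressian.dim 3 n ≤ ((n - 2).choose 2 : ℤ) - 1) ∧
    (∀ n : ℕ, 5 ≤ n → (n : ℝ) ^ 2 / 24 - (n : ℝ) / 12 - 1 ≤ (Dressian.dim 3 n : ℝ)) := by
  refine ⟨⟨?_, ?_⟩, fun n => Dressian.dim_le, fun n => Dressian.le_dim⟩
  · refine IsBigO.of_bound 1 ?_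
    filter_upwards [eventually_ge_atTop 10] with n hn
    have h10 : (10 : ℝ) ≤ n := by exact_mod_cast hn
    have h1 := Dressian.le_dim (n := n) (by omega)
    have h2 : (Dressian.dim 3 n : ℝ) ≤ ((n - 2).choose 2 : ℕ) - 1 := by
      exact_mod_cast Dressian.dim_le (n := n) (by omega)
    have h3 : (((n - 2).choose 2 : ℕ) : ℝ) ≤ (n : ℝ) ^ 2 := by
      exact_mod_cast (Nat.choose_le_pow _ 2).trans (Nat.pow_le_pow_left (Nat.sub_le n 2) 2)
    rw [Real.norm_of_nonneg (by nlinarith), Real.norm_of_nonneg (by positivity)]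
    linarith
  · refine IsBigO.of_bound 48 ?_
    -- The lower bound is at least `n ^ 2 / 48` once `n ^ 2 ≥ 4 * n + 48`, which holds from `n = 10`
    -- on.
    filter_upwards [eventually_ge_atTop 10] with n hn
    have h10 : (10 : ℝ) ≤ n := by exact_mod_cast hn
    have h1 := Dressian.le_dim (n := n) (by omega)
    rw [Real.norm_of_nonneg (by positivity), Real.norm_of_nonneg (by nlinarith)]
    nlinarith
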